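/- Let $k$ be a perfect field, let $X$ and $Y$ be normal projective varieties over $k$ (integral, normal, closed subschemes of some projective space over $k$), and let $f\colon X\to Y$ be a finite surjective morphism over $k$. **Definitions.** For a normal projective variety $V$ over $k$ let $\operatorname{Div}(V)$ be the group of Cartier divisors on $V$. A $\mathbb{Q}$-divisor (respectively $\mathbb{R}$-divisor) on $V$ is an element of $\operatorname{Div}(V)\otimes_{\mathbb Z}\mathbb{Q}$ (respectively $\operatorname{Div}(V)\otimes_{\mathbb Z}\mathbb{R}$). For a Cartier divisor $L$ on $V$ let $\operatorname{Bs}(L)$ be the set of common zeros of all global sections of $\mathcal{O}_V(L)$, and let $\mathbf{B}(L)=\bigl(\bigcap_{m\ge 1}\operatorname{Bs}(mL)\bigr)_{\mathrm{red}}$. The stable base locus of a $\mathbb{Q}$-divisor $D$ is $\mathbf{B}(D)=\mathbf{B}(bD)$, where $b\ge 1$ is any integer such that $bD$ is Cartier; it does not depend on $b$. For an $\mathbb{R}$-divisor $\Delta$ on $V$, choose an ample Cartier divisor $A$ and a representation $\Delta\sim_{\mathbb{R}}\sum_i t_iA_i$ with $t_i\in\mathbb{R}$ and $A_i$ very ample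 Cartier divisors, where $\sim_{\mathbb{R}}$ means that the difference is a real linear combination of principal Cartier divisors. The augmented base locus of $\Delta$ with respect to these choices is $$\mathbf{B}_+(\Delta)=\Bigl(\bigcap_{m\ge 1}\mathbf{B}\bigl(\textstyle\sum_i\lfloor mt_i\rfloor A_i-A\bigr)\Bigr)_{\mathrm{red}}.$$ For a closed subscheme $Z\subseteq Y$, $f^{-1}Z$ denotes the reduced scheme associated to the scheme-theoretic preimage of $Z$. **Theorem.** 1. For every $\mathbb{Q}$-divisor $D$ on $Y$ one has $\mathbf{B}(f^*D)=f^{-1}\mathbf{B}(D)$, as reduced closed subschemes of $X$. 2. For every $\mathbb{R}$-divisor $\Delta$ on $Y$ one has $\mathbf{B}_+(f^*\Delta)=f^{-1}\mathbf{B}_+(\Delta)$, as reduced closed subschemes of $X$, whatever choices are used to define $\mathbf{B}_+(\Delta)$ on $Y$ and $\mathbf{B}_+(f^*\Delta)$ on $X$. -/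

import Mathlib

open AlgebraicGeometry CategoryTheory TopologicalSpace
open scoped TensorProduct

universe u

noncomputable section

namespace BaseLoci

/-! ### Normal and projective varieties -/

/-- A scheme is normal if all its local rings are integrally closed domains. -/
class IsNormalScheme (X : Scheme.{u}) : Prop where
  isDomain_stalk : ∀ x : X, IsDomain (X.presheaf.stalk x)
  isIntegrallyClosed_stalk : ∀ x : X, IsIntegrallyClosed (X.presheaf.stalk x)

section ProjectiveSpace

variable (k : Type u) [Field k] (n : ℕ)

/-- The grading of `k[x₀, …, xₙ]` by degree. -/
abbrev polyGrading : ℕ → Submodule k (MvPolynomial (Fin (n + 1)) k) :=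
  MvPolynomial.homogeneousSubmodule (Fin (n + 1)) k

instance gradedAlgebraPolyGrading : GradedAlgebra (polyGrading k n) := MvPolynomial.gradedAlgebra

/-- Projective `n`-space over `k`, as `Proj k[x₀, …, xₙ]`. -/
abbrev projSpace : Scheme.{u} := Proj (polyGrading k n)

/-- The structure morphism of projective space. -/
def projSpaceToSpec : projSpace k n ⟶ Spec (CommRingCat.of k) :=
  Proj.toSpecZero (polyGrading k n) ≫
    Spec.map (CommRingCat.ofHom (algebraMap k (polyGrading k n 0)))

/-- The standard open `D₊(xⱼ)` of projective space. -/
abbrev stdOpen (j : Fin (n + 1)) : (projSpace k n).Opens :=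
  Proj.basicOpen (polyGrading k n) (MvPolynomial.X j)

/-- The regular function `xₗ / xⱼ` on `D₊(xⱼ)`. -/
def coordRatio (l j : Fin (n + 1)) : Γ(projSpace k n, stdOpen k n j) :=
  (Proj.awayToSection (polyGrading k n) (MvPolynomial.X j)).hom
    (HomogeneousLocalization.Away.mk (polyGrading k n) (d := 1)
      (MvPolynomial.isHomogeneous_X k j) 1 (MvPolynomial.X l)
      (MvPolynomial.isHomogeneous_X k l))

end ProjectiveSpace

/-- The `k`-scheme `X` with structure morphism `s` is projective: it has a closed `k`-immersion into
some projective space over `k`. In particular it is separated and of finite type over `k`. -/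
def IsProjectiveOver (k : Type u) [Field k] (X : Scheme.{u})
    (s : X ⟶ Spec (CommRingCat.of k)) : Prop :=
  ∃ (n : ℕ) (i : X ⟶ projSpace k n), IsClosedImmersion i ∧ i ≫ projSpaceToSpec k n = s

/-! ### Cartier divisors on an integral scheme -/

section Cartier

variable (X : Scheme.{u}) [IsIntegral X]

/-- The image of `𝒪_{X,x}ˣ` in the multiplicative group of the function field. -/
def localUnits (x : X) : Subgroup (X.functionField)ˣ :=
  (Units.map (algebraMap (X.presheaf.stalk x) X.functionField :
    X.presheaf.stalk x →* X.functionField)).range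

/-- The global sections of the quotient sheaf `𝒦ˣ / 𝒪ˣ`, where `𝒦` is the constant sheaf of
rational functions. The stalk of this sheaf at `x` is `K(X)ˣ / 𝒪_{X,x}ˣ`, and a section is a family
of germs that is locally induced by one rational function, a local equation. -/
def cartierSubgroup : Subgroup (∀ x : X, (X.functionField)ˣ ⧸ localUnits X x) where
  carrier := {D | ∀ x : X, ∃ U : X.Opens, x ∈ U ∧
    ∃ e : (X.functionField)ˣ, ∀ y ∈ U, D y = QuotientGroup.mk e}
  one_mem' x := ⟨⊤, trivial, 1, fun _ _ ↦ rfl⟩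
  mul_mem' {D D'} h h' x := by
    obtain ⟨U, hU, e, he⟩ := h x
    obtain ⟨U', hU', e', he'⟩ := h' x
    refine ⟨U ⊓ U', ⟨hU, hU'⟩, e * e', fun y hy ↦ ?_⟩
    rw [Pi.mul_apply, he y hy.1, he' y hy.2, QuotientGroup.mk_mul]
  inv_mem' {D} h x := by
    obtain ⟨U, hU, e, he⟩ := h x
    exact ⟨U, hU, e⁻¹, fun y hy ↦ by rw [Pi.inv_apply, he y hy, QuotientGroup.mk_inv]⟩

/-- The group `Div(X)` of Cartier divisors, written additively. -/
abbrev CartierDivisor : Type u := Additive (cartierSubgroup X)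

instance addCommGroupCartierDivisor : AddCommGroup (CartierDivisor X) := inferInstance

variable {X}

/-- The germ of a Cartier divisor at a point. -/
def germAt (D : CartierDivisor X) (x : X) : (X.functionField)ˣ ⧸ localUnits X x :=
  D.toMul.1 x

/-- The principal Cartier divisor of a nonzero rational function. -/
def principal (g : (X.functionField)ˣ) : CartierDivisor X :=
  Additive.ofMul ⟨fun _ ↦ QuotientGroup.mk g, fun _ ↦ ⟨⊤, trivial, g, fun _ _ ↦ rfl⟩⟩

/-- The rational function `g` is a section of `𝒪_X(D)` near `x`: for a local equation `e` of `D`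
at `x`, the product `e * g` is regular at `x`. -/
def IsSectionAt (D : CartierDivisor X) (g : X.functionField) (x : X) : Prop :=
  ∃ (e : (X.functionField)ˣ) (a : X.presheaf.stalk x), QuotientGroup.mk e = germAt D x ∧
    algebraMap (X.presheaf.stalk x) X.functionField a = e * g

/-- The rational function `g` is a section of `𝒪_X(D)` near `x` that does not vanish at `x`: for
a local equation `e` of `D` at `x`, the product `e * g` is a unit of the local ring at `x`. -/
def IsNonvanishingAt (D : CartierDivisor X) (g : X.functionField) (x : X) : Prop :=
  ∃ (e : (X.functionField)ˣ) (a : X.presheaf.stalk x), QuotientGroup.mk e = germAt D x ∧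
    IsUnit a ∧ algebraMap (X.presheaf.stalk x) X.functionField a = e * g

/-- `H⁰(X, 𝒪_X(D))`, as a set of rational functions. -/
def globalSections (D : CartierDivisor X) : Set X.functionField :=
  {g | ∀ x : X, IsSectionAt D g x}

theorem isNonvanishingAt_iff (D : CartierDivisor X) (g : X.functionField) (x : X)
    (e : (X.functionField)ˣ) (he : QuotientGroup.mk e = germAt D x) :
    IsNonvanishingAt D g x ↔ ∃ a : X.presheaf.stalk x, IsUnit a ∧
      algebraMap (X.presheaf.stalk x) X.functionField a = e * g := by
  constructor
  · rintro ⟨e', a, he', ha, hag⟩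
    obtain ⟨c, hc⟩ := QuotientGroup.eq.mp (he'.trans he.symm)
    refine ⟨c * a, c.isUnit.mul ha, ?_⟩
    have hc' : algebraMap (X.presheaf.stalk x) X.functionField c = (e' : X.functionField)⁻¹ * e := by
      simpa using congrArg Units.val hc
    rw [map_mul, hc', hag]
    field_simp
  · rintro ⟨a, ha, hag⟩
    exact ⟨e, a, he, ha, hag⟩

theorem isOpen_setOf_isNonvanishingAt (D : CartierDivisor X) (g : X.functionField) :
    IsOpen {x : X | IsNonvanishingAt D g x} := by
  rw [isOpen_iff_forall_mem_open]
  intro x hx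
  obtain ⟨U, hxU, e, he⟩ := D.toMul.2 x
  obtain ⟨a, ha, hag⟩ := (isNonvanishingAt_iff D g x e (he x hxU).symm).mp hx
  obtain ⟨V, hxV, b, rfl⟩ := X.presheaf.exists_germ_eq a
  have hxb : x ∈ X.basicOpen b := (X.mem_basicOpen b x hxV).mpr ha
  refine ⟨(U ⊓ X.basicOpen b : X.Opens), ?_, (U ⊓ X.basicOpen b).2, ⟨hxU, hxb⟩⟩
  rintro y ⟨hyU, hyb⟩
  have hyV : y ∈ V := X.basicOpen_le b hyb
  refine (isNonvanishingAt_iff D g y e (he y hyU).symm).mpr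
    ⟨X.presheaf.germ V y hyV b, (X.mem_basicOpen b y hyV).mp hyb, ?_⟩
  have : Nonempty V := ⟨⟨x, hxV⟩⟩
  rw [← hag, Scheme.algebraMap_germ_eq_germToFunctionField,
    Scheme.algebraMap_germ_eq_germToFunctionField]

/-- The open set `X_g` where the section `g` of `𝒪_X(D)` does not vanish. -/
def nonvanishingLocus (D : CartierDivisor X) (g : X.functionField) : X.Opens :=
  ⟨{x | IsNonvanishingAt D g x}, isOpen_setOf_isNonvanishingAt D g⟩

/-- A Cartier divisor `A` on a quasi-compact integral scheme is ample if every point lies in an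
affine open set `X_g`, where `g` is a global section of some `𝒪_X(nA)` with `n ≥ 1`. -/
def IsAmple (A : CartierDivisor X) : Prop :=
  CompactSpace X ∧ ∀ x : X, ∃ n : ℕ, 0 < n ∧ ∃ g ∈ globalSections (n • A),
    x ∈ nonvanishingLocus (n • A) g ∧ IsAffineOpen (nonvanishingLocus (n • A) g)

/-- A Cartier divisor `A` on `X` is very ample over `k` if there is a `k`-immersion `i` of `X` into
some projective space with `i^* 𝒪(1) ≅ 𝒪_X(A)`. Such an isomorphism is the same thing as the
sections `g j` of `𝒪_X(A)` that correspond to the `i^* xⱼ`: the section `g j` generates `𝒪_X(A)`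
exactly over the preimage of `D₊(xⱼ)`, and there `g l / g j` is the pullback of `xₗ / xⱼ`. -/
def IsVeryAmple (k : Type u) [Field k] (s : X ⟶ Spec (CommRingCat.of k))
    (A : CartierDivisor X) : Prop :=
  ∃ (n : ℕ) (i : X ⟶ projSpace k n), IsImmersion i ∧ i ≫ projSpaceToSpec k n = s ∧
    ∃ g : Fin (n + 1) → X.functionField,
      (∀ j, g j ∈ globalSections A) ∧
      (∀ j, nonvanishingLocus A (g j) = i ⁻¹ᵁ stdOpen k n j) ∧
      ∀ (l j : Fin (n + 1)) (x : X) (hx : x ∈ i ⁻¹ᵁ stdOpen k n j),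
        g l = algebraMap (X.presheaf.stalk x) X.functionField
          (X.presheaf.germ (i ⁻¹ᵁ stdOpen k n j) x hx
            ((i.app (stdOpen k n j)).hom (coordRatio k n l j))) * g j

/-! ### Base loci -/

/-- The base locus of the complete linear system `|L|`, as a closed set: the common zeros of all
global sections of `𝒪_X(L)` (all of `X` if there is no nonzero section). -/
def baseLocus (L : CartierDivisor X) : Closeds X :=
  ⟨{x | ∀ g ∈ globalSections L, ¬ IsNonvanishingAt L g x}, by
    have h : {x : X | ∀ g ∈ globalSections L, ¬ IsNonvanishingAt L g x} =
        ⋂ g ∈ globalSections L, {x | IsNonvanishingAt L g x}ᶜ := by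
      ext x
      simp
    rw [h]
    exact isClosed_biInter fun g _ ↦ (isOpen_setOf_isNonvanishingAt L g).isClosed_compl⟩

/-- The closed set underlying the stable base locus of a Cartier divisor. -/
def stableBaseSet (L : CartierDivisor X) : Closeds X :=
  ⨅ (m : ℕ) (_ : 0 < m), baseLocus (m • L)

variable (X) in
/-- `Div(X) ⊗ ℚ`. -/
abbrev QDivisor : Type u := ℚ ⊗[ℤ] CartierDivisor X

variable (X) in
/-- `Div(X) ⊗ ℝ`. -/
abbrev RDivisor : Type u := ℝ ⊗[ℤ] CartierDivisor X

/-- The closed set underlying the stable base locus of a `ℚ`-divisor `D`. It equals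
`stableBaseSet L` for each Cartier divisor `L = bD` with `b ≥ 1`, see `stableBaseSetQ_eq`. -/
def stableBaseSetQ (D : QDivisor X) : Closeds X :=
  ⨅ (b : ℕ) (_ : 0 < b) (L : CartierDivisor X) (_ : b • D = 1 ⊗ₜ[ℤ] L), stableBaseSet L

theorem mk_eq_germAt_nsmul {L : CartierDivisor X} {x : X} {e : (X.functionField)ˣ}
    (he : QuotientGroup.mk e = germAt L x) (n : ℕ) :
    QuotientGroup.mk (e ^ n) = germAt (n • L) x := by
  rw [QuotientGroup.mk_pow, he]
  rfl

theorem baseLocus_nsmul_le (L : CartierDivisor X) (n : ℕ) :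
    baseLocus (n • L) ≤ baseLocus L := by
  rintro x hx g hg ⟨e, a, he, ha, hag⟩
  refine hx (g ^ n) (fun y ↦ ?_) ⟨e ^ n, a ^ n, mk_eq_germAt_nsmul he n, ha.pow n, ?_⟩
  · obtain ⟨e', a', he', hag'⟩ := hg y
    refine ⟨e' ^ n, a' ^ n, mk_eq_germAt_nsmul he' n, ?_⟩
    rw [map_pow, hag', mul_pow, Units.val_pow_eq_pow_val]
  · rw [map_pow, hag, mul_pow, Units.val_pow_eq_pow_val]

theorem stableBaseSet_nsmul (L : CartierDivisor X) {n : ℕ} (hn : 0 < n) :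
    stableBaseSet (n • L) = stableBaseSet L := by
  refine le_antisymm (le_iInf₂ fun m hm ↦ ?_) (le_iInf₂ fun m hm ↦ ?_)
  · refine (iInf₂_le m hm).trans ?_
    rw [smul_comm]
    exact baseLocus_nsmul_le _ n
  · rw [smul_smul]
    exact iInf₂_le (m * n) (Nat.mul_pos hm hn)

theorem stableBaseSetQ_eq {D : QDivisor X} {b : ℕ} (hb : 0 < b) {L : CartierDivisor X}
    (h : b • D = 1 ⊗ₜ[ℤ] L) : stableBaseSetQ D = stableBaseSet L := by
  refine le_antisymm (iInf₂_le_of_le b hb (iInf₂_le L h)) ?_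
  refine le_iInf₂ fun b' hb' ↦ le_iInf₂ fun L' h' ↦ ?_
  have key : (1 : ℚ) ⊗ₜ[ℤ] (b' • L) = (1 : ℚ) ⊗ₜ[ℤ] (b • L') := by
    rw [TensorProduct.tmul_smul, TensorProduct.tmul_smul, ← h, ← h', smul_comm]
  obtain ⟨c, hc⟩ := (IsLocalizedModule.eq_iff_exists (nonZeroDivisors ℤ)
    (TensorProduct.mk ℤ ℚ (CartierDivisor X) 1)).mp key
  have hc0 : (c : ℤ) ≠ 0 := nonZeroDivisors.ne_zero c.2
  have hn : 0 < (c : ℤ).natAbs := Int.natAbs_pos.mpr hc0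
  have hc' : (c : ℤ).natAbs • b' • L = (c : ℤ).natAbs • b • L' := by
    have hc1 : (c : ℤ) • b' • L = (c : ℤ) • b • L' := hc
    rcases Int.natAbs_eq (c : ℤ) with h1 | h1 <;> rw [h1] at hc1
    · simpa only [natCast_zsmul] using hc1
    · simpa only [neg_smul, natCast_zsmul, neg_inj] using hc1
  rw [← stableBaseSet_nsmul L hb', ← stableBaseSet_nsmul (b' • L) hn, hc',
    stableBaseSet_nsmul _ hn, stableBaseSet_nsmul _ hb]

/-- The stable base locus `𝐁(D)` of a `ℚ`-divisor, as a reduced closed subscheme (given by its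
ideal sheaf). -/
def stableBaseLocus (D : QDivisor X) : X.IdealSheafData :=
  Scheme.IdealSheafData.vanishingIdeal (stableBaseSetQ D)

/-- `ℝ`-linear equivalence: the difference is a real linear combination of principal Cartier
divisors. -/
def RLinearEquiv (Δ₁ Δ₂ : RDivisor X) : Prop :=
  Δ₁ - Δ₂ ∈ Submodule.span ℝ
    (Set.range fun g : (X.functionField)ˣ ↦ (1 : ℝ) ⊗ₜ[ℤ] principal g)

/-- The choices in the definition of the augmented base locus of an `ℝ`-divisor `Δ`: an ample
Cartier divisor `A` and a representation `Δ ∼_ℝ ∑ tᵢ Aᵢ` with real `tᵢ` and very ample Cartier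
divisors `Aᵢ`. -/
structure AugmentedChoice (k : Type u) [Field k] (s : X ⟶ Spec (CommRingCat.of k))
    (Δ : RDivisor X) where
  /-- the ample divisor -/
  A : CartierDivisor X
  isAmple : IsAmple A
  /-- the number of terms of the representation -/
  r : ℕ
  /-- the coefficients -/
  t : Fin r → ℝ
  /-- the very ample divisors -/
  B : Fin r → CartierDivisor X
  isVeryAmple : ∀ i, IsVeryAmple k s (B i)
  equiv : RLinearEquiv Δ (∑ i, t i ⊗ₜ[ℤ] B i)

/-- The augmented base locus `𝐁₊(Δ) = (⋂_{m ≥ 1} 𝐁(∑ ⌊m tᵢ⌋ Aᵢ - A))_red`, computed with the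
given choices, as a reduced closed subscheme (given by its ideal sheaf). -/
def augmentedBaseLocus {k : Type u} [Field k] {s : X ⟶ Spec (CommRingCat.of k)}
    {Δ : RDivisor X} (c : AugmentedChoice k s Δ) : X.IdealSheafData :=
  Scheme.IdealSheafData.vanishingIdeal
    (⨅ (m : ℕ) (_ : 0 < m), stableBaseSet ((∑ i, ⌊(m : ℝ) * c.t i⌋ • c.B i) - c.A))

end Cartier

/-! ### Pullback -/

section Pullback

variable {X Y : Scheme.{u}} [IsIntegral X] [IsIntegral Y] (f : X ⟶ Y) [IsDominant f]

theorem specializes_genericPoint : f (genericPoint X) ⤳ genericPoint Y := by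
  have h := (genericPoint_spec X).image f.continuous
  rw [Set.image_univ, f.denseRange.closure_range] at h
  exact h.specializes trivial

/-- The inclusion of function fields induced by a dominant morphism. -/
def functionFieldMap : Y.functionField →+* X.functionField :=
  (Y.presheaf.stalkSpecializes (specializes_genericPoint f) ≫ f.stalkMap (genericPoint X)).hom

theorem functionFieldMap_algebraMap (x : X) (a : Y.presheaf.stalk (f x)) :
    functionFieldMap f (algebraMap (Y.presheaf.stalk (f x)) Y.functionField a) =
      algebraMap (X.presheaf.stalk x) X.functionField ((f.stalkMap x).hom a) := by
  have h := Scheme.Hom.stalkSpecializes_stalkMap f (genericPoint X) x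
    ((genericPoint_spec X).specializes trivial)
  have h' := Y.presheaf.stalkSpecializes_comp (specializes_genericPoint f)
    ((genericPoint_spec Y).specializes (Set.mem_univ (f x)))
  have h'' := DFunLike.congr_fun (CommRingCat.hom_ext_iff.mp h) a
  rw [← h'] at h''
  exact h''

theorem localUnits_le_comap (x : X) :
    localUnits Y (f x) ≤ (localUnits X x).comap
      (Units.map (functionFieldMap f : Y.functionField →* X.functionField)) := by
  rintro _ ⟨c, rfl⟩
  refine ⟨Units.map ((f.stalkMap x).hom : Y.presheaf.stalk (f x) →* X.presheaf.stalk x) c, ?_⟩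
  ext
  exact (functionFieldMap_algebraMap f x c).symm

/-- The map on germs of Cartier divisors: a local equation at `f x` is pulled back to a local
equation at `x`. -/
def pullbackGerm (x : X) :
    (Y.functionField)ˣ ⧸ localUnits Y (f x) →* (X.functionField)ˣ ⧸ localUnits X x :=
  QuotientGroup.map _ _ (Units.map (functionFieldMap f : Y.functionField →* X.functionField))
    (localUnits_le_comap f x)

/-- The pullback `f^*` of Cartier divisors along a dominant morphism. -/
def pullbackCartier : CartierDivisor Y →+ CartierDivisor X :=
  MonoidHom.toAdditive
    { toFun := fun D ↦ ⟨fun x ↦ pullbackGerm f x (D.1 (f x)), fun x ↦ by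
        obtain ⟨U, hU, e, he⟩ := D.2 (f x)
        refine ⟨f ⁻¹ᵁ U, hU,
          Units.map (functionFieldMap f : Y.functionField →* X.functionField) e, fun y hy ↦ ?_⟩
        exact congrArg (pullbackGerm f y) (he (f y) hy)⟩
      map_one' := Subtype.ext (funext fun x ↦ map_one (pullbackGerm f x))
      map_mul' := fun D D' ↦ Subtype.ext (funext fun x ↦ map_mul (pullbackGerm f x) _ _) }

/-- The pullback of `ℚ`-divisors. -/
def pullbackQ : QDivisor Y →ₗ[ℚ] QDivisor X :=
  (pullbackCartier f).toIntLinearMap.baseChange ℚ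

/-- The pullback of `ℝ`-divisors. -/
def pullbackR : RDivisor Y →ₗ[ℝ] RDivisor X :=
  (pullbackCartier f).toIntLinearMap.baseChange ℝ

/-- The reduced scheme associated to the scheme-theoretic preimage of a closed subscheme. -/
def reducedPreimage {X Y : Scheme.{u}} (f : X ⟶ Y) (Z : Y.IdealSheafData) : X.IdealSheafData :=
  (Z.comap f).radical

end Pullback

end BaseLoci

end

/-!
If `g` is a section of `𝒪(f^* D)` and `Y` is normal, the minimal polynomial of `g` over the function
field of `Y`, of degree `n`, has as its `i`-th coefficient a section of `𝒪((n - i) D)`. Near `f x`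
a local equation of `D` makes this a monic polynomial over the local ring, of which the germ of `g`
is a root; if that germ is a unit, some lower coefficient is a unit as well. Hence `f x` is outside
`𝐁(D)` as soon as `x` is outside `𝐁(f^* D)`.

For `𝐁₊`, the Cartier divisors `L` with `x ∉ 𝐁(L)` form a monoid closed under division, so they are
exactly the integral elements of the real convex cone that they generate. That cone contains all
multiples of principal divisors, and `x ∉ 𝐁₊(Δ)` holds exactly when `Δ - ε A` lies in it for some
`ε > 0`. This criterion depends neither on the representation of `Δ` nor on `A`, so `𝐁₊(f^* Δ)` may
be computed with the pullback of the choices made on `Y`.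
-/

noncomputable section

namespace BaseLoci

/-! ### Clearing denominators -/

theorem exists_linearMap_rat_pos {V : Type*} [AddCommGroup V] [Module ℚ V] (ψ : V →ₗ[ℚ] ℝ)
    (S : Finset V) (hS : ∀ s ∈ S, 0 < ψ s) : ∃ φ : V →ₗ[ℚ] ℚ, ∀ s ∈ S, 0 < φ s := by
  let b := Module.Basis.ofVectorSpace ℚ V
  let ev (v : Module.Basis.ofVectorSpaceIndex ℚ V → ℝ) : V →ₗ[ℚ] ℝ := b.constr ℚ v
  have hcont (s : V) : Continuous fun v ↦ ev v s := by
    simp only [ev, Module.Basis.constr_apply, Finsupp.sum, Rat.smul_def]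
    fun_prop
  have hopen : IsOpen {v | ∀ s ∈ S, 0 < ev v s} := by
    simp only [Set.ofPred_forall]
    exact isOpen_biInter_finset fun s _ ↦ isOpen_lt continuous_const (hcont s)
  have hψ : ev (fun i ↦ ψ (b i)) = ψ := b.constr_self ℚ ψ
  have hmem : (fun i ↦ ψ (b i)) ∈ {v | ∀ s ∈ S, 0 < ev v s} := by
    intro s hs
    rw [hψ]
    exact hS s hs
  obtain ⟨q, hq⟩ := (DenseRange.piMap fun _ ↦ Rat.denseRange_cast (𝕜 := ℝ)).exists_mem_open
    hopen ⟨_, hmem⟩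
  have hev : ev (Pi.map (fun _ ↦ Rat.cast) q) = Algebra.linearMap ℚ ℝ ∘ₗ b.constr ℚ q :=
    b.ext fun i ↦ by simp [ev]
  refine ⟨b.constr ℚ q, fun s hs ↦ ?_⟩
  have hpos : 0 < ev (Pi.map (fun _ ↦ Rat.cast) q) s := hq s hs
  rw [hev] at hpos
  exact Rat.cast_pos.mp hpos

section TensorProduct

variable {M : Type*} [AddCommGroup M]

theorem exists_nsmul_eq_one_tmul (z : ℚ ⊗[ℤ] M) :
    ∃ n : ℕ, 0 < n ∧ ∃ y : M, n • z = 1 ⊗ₜ[ℤ] y := by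
  obtain ⟨⟨y, c⟩, hc⟩ :=
    IsLocalizedModule.surj (nonZeroDivisors ℤ) (TensorProduct.mk ℤ ℚ M 1) z
  replace hc : (c : ℤ) • z = 1 ⊗ₜ[ℤ] y := hc
  refine ⟨(c : ℤ).natAbs, Int.natAbs_pos.mpr (nonZeroDivisors.ne_zero c.2), ?_⟩
  rcases Int.natAbs_eq (c : ℤ) with h | h <;> rw [h] at hc
  · exact ⟨y, by rw [← hc, natCast_zsmul]⟩
  · exact ⟨-y, by rw [TensorProduct.tmul_neg, ← hc, neg_smul, natCast_zsmul, neg_neg]⟩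

theorem exists_nsmul_eq_nsmul_of_one_tmul_eq {x y : M}
    (h : (1 : ℚ) ⊗ₜ[ℤ] x = 1 ⊗ₜ[ℤ] y) : ∃ n : ℕ, 0 < n ∧ n • x = n • y := by
  obtain ⟨c, hc⟩ := (IsLocalizedModule.eq_iff_exists (nonZeroDivisors ℤ)
    (TensorProduct.mk ℤ ℚ M 1)).mp h
  replace hc : (c : ℤ) • x = (c : ℤ) • y := hc
  refine ⟨(c : ℤ).natAbs, Int.natAbs_pos.mpr (nonZeroDivisors.ne_zero c.2), ?_⟩
  rcases Int.natAbs_eq (c : ℤ) with h | h <;> rw [h] at hc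
  · simpa only [natCast_zsmul] using hc
  · simpa only [neg_smul, natCast_zsmul, neg_inj] using hc

theorem exists_nsmul_eq_one_tmul_of_mem_hull_rat {C : AddSubmonoid M} {z : ℚ ⊗[ℤ] M}
    (hz : z ∈ PointedCone.hull ℚ ((1 ⊗ₜ[ℤ] ·) '' (C : Set M))) :
    ∃ n : ℕ, 0 < n ∧ ∃ y ∈ C, n • z = 1 ⊗ₜ[ℤ] y := by
  induction hz using Submodule.span_induction with
  | mem z hz =>
    obtain ⟨y, hy, rfl⟩ := hz
    exact ⟨1, one_pos, y, hy, one_smul _ _⟩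
  | zero => exact ⟨1, one_pos, 0, zero_mem C, by simp⟩
  | add z z' _ _ hz hz' =>
    obtain ⟨n, hn, y, hy, h⟩ := hz
    obtain ⟨n', hn', y', hy', h'⟩ := hz'
    refine ⟨n * n', Nat.mul_pos hn hn', n' • y + n • y',
      add_mem (nsmul_mem hy n') (nsmul_mem hy' n), ?_⟩
    rw [TensorProduct.tmul_add, TensorProduct.tmul_smul, TensorProduct.tmul_smul, ← h, ← h',
      smul_add, mul_comm, mul_smul, mul_comm, mul_smul]
  | smul q z _ hz =>
    obtain ⟨n, hn, y, hy, h⟩ := hz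
    obtain ⟨q, hq⟩ := q
    obtain ⟨a, ha⟩ := Int.eq_ofNat_of_zero_le (Rat.num_nonneg.mpr hq)
    refine ⟨q.den * n, Nat.mul_pos q.den_pos hn, a • y, nsmul_mem hy a, ?_⟩
    change (q.den * n) • q • z = _
    rw [mul_smul, ← smul_comm q, h, ← Nat.cast_smul_eq_nsmul ℚ, smul_smul, Rat.den_mul_eq_num,
      TensorProduct.tmul_smul, ha, Int.cast_natCast, Nat.cast_smul_eq_nsmul]

theorem mem_of_one_tmul_mem_hull_rat {C : AddSubmonoid M}
    (hC : ∀ n : ℕ, 0 < n → ∀ x, n • x ∈ C → x ∈ C) {x : M}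
    (hx : 1 ⊗ₜ[ℤ] x ∈ PointedCone.hull ℚ ((1 ⊗ₜ[ℤ] · : M → ℚ ⊗[ℤ] M) '' C)) : x ∈ C := by
  obtain ⟨n, hn, y, hy, h⟩ := exists_nsmul_eq_one_tmul_of_mem_hull_rat hx
  rw [← TensorProduct.tmul_smul] at h
  obtain ⟨m, hm, hmx⟩ := exists_nsmul_eq_nsmul_of_one_tmul_eq h
  exact hC n hn x (hC m hm _ (hmx ▸ nsmul_mem hy m))

theorem mem_of_one_tmul_mem_hull_real {C : AddSubmonoid M}
    (hC : ∀ n : ℕ, 0 < n → ∀ x, n • x ∈ C → x ∈ C) {x : M}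
    (hx : 1 ⊗ₜ[ℤ] x ∈ PointedCone.hull ℝ ((1 ⊗ₜ[ℤ] · : M → ℝ ⊗[ℤ] M) '' C)) : x ∈ C := by
  -- A `ℚ`-linear map `ℝ → ℚ` that is positive on `1` and on the finitely many coefficients of a
  -- representation of `1 ⊗ₜ x` turns it into a representation with rational coefficients.
  obtain ⟨r, hr, hsum⟩ := (Finsupp.mem_span_image_iff_linearCombination _).mp hx
  obtain ⟨φ, hφ⟩ := exists_linearMap_rat_pos (LinearMap.id : ℝ →ₗ[ℚ] ℝ)
    (insert 1 (r.support.image fun y ↦ (r y : ℝ))) <| by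
      simp only [Finset.mem_insert, Finset.mem_image, Finsupp.mem_support_iff, LinearMap.id_apply]
      rintro _ (rfl | ⟨y, hy, rfl⟩)
      exacts [one_pos, (r y).2.lt_of_ne' (Subtype.coe_ne_coe.mpr hy)]
  have hφ1 : 0 < φ 1 := hφ 1 (Finset.mem_insert_self _ _)
  let Φ : ℝ ⊗[ℤ] M →ₗ[ℤ] ℚ ⊗[ℤ] M := (φ.restrictScalars ℤ).rTensor M
  have hΦ : φ 1 • (1 ⊗ₜ[ℤ] x : ℚ ⊗[ℤ] M) =
      ∑ y ∈ r.support, φ (r y) • (1 ⊗ₜ[ℤ] y : ℚ ⊗[ℤ] M) := by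
    have hterm (c : ℝ) (y : M) : Φ (c • 1 ⊗ₜ[ℤ] y) = φ c • 1 ⊗ₜ[ℤ] y := by
      simp only [Φ, TensorProduct.smul_tmul', smul_eq_mul, mul_one]
      rfl
    rw [← hterm, one_smul, ← hsum, Finsupp.linearCombination_apply, Finsupp.sum, map_sum]
    exact Finset.sum_congr rfl fun y _ ↦ hterm (r y) y
  refine mem_of_one_tmul_mem_hull_rat hC ?_
  rw [← inv_smul_smul₀ hφ1.ne' (1 ⊗ₜ[ℤ] x), hΦ]
  refine PointedCone.smul_mem _ (inv_nonneg.mpr hφ1.le) (sum_mem fun y hy ↦ ?_)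
  refine PointedCone.smul_mem _ (hφ _ ?_).le (Submodule.subset_span ⟨y, hr hy, rfl⟩)
  exact Finset.mem_insert_of_mem (Finset.mem_image_of_mem _ hy)

end TensorProduct

/-! ### Sections of divisors -/

section Sections

variable {X : Scheme.{u}} [IsIntegral X]

variable (X) in
/-- The local ring at `x`, as a subring of the function field. -/
def stalkSubring (x : X) : Subring X.functionField :=
  (algebraMap (X.presheaf.stalk x) X.functionField).range

theorem germToFunctionField_mem_stalkSubring {U : X.Opens} [Nonempty U] {x : X} (hx : x ∈ U)
    (a : Γ(X, U)) : X.germToFunctionField U a ∈ stalkSubring X x :=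
  ⟨X.presheaf.germ U x hx a, Scheme.algebraMap_germ_eq_germToFunctionField X hx a⟩

theorem germToFunctionField_res {U V : X.Opens} [Nonempty U] [Nonempty V] (i : V ⟶ U)
    (a : Γ(X, U)) :
    X.germToFunctionField V (X.presheaf.map i.op a) = X.germToFunctionField U a :=
  X.presheaf.germ_res_apply i _ _ a

theorem exists_le_germToFunctionField_eq {U : X.Opens} {x : X} (hxU : x ∈ U)
    {h : X.functionField} (hh : h ∈ stalkSubring X x) :
    ∃ (V : X.Opens) (_ : V ≤ U) (_ : x ∈ V) (_ : Nonempty V) (b : Γ(X, V)),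
      X.germToFunctionField V b = h := by
  obtain ⟨c, rfl⟩ := hh
  obtain ⟨V, hxV, b, rfl⟩ := X.presheaf.exists_germ_eq c
  have hx : x ∈ U ⊓ V := ⟨hxU, hxV⟩
  have : Nonempty V := ⟨⟨x, hxV⟩⟩
  have : Nonempty (U ⊓ V : X.Opens) := ⟨⟨x, hx⟩⟩
  refine ⟨U ⊓ V, inf_le_left, hx, this, X.presheaf.map (homOfLE inf_le_right).op b, ?_⟩
  rw [germToFunctionField_res, Scheme.algebraMap_germ_eq_germToFunctionField]

theorem exists_germToFunctionField_eq {U : X.Opens} [Nonempty U] {h : X.functionField}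
    (hh : ∀ x ∈ U, h ∈ stalkSubring X x) : ∃ a : Γ(X, U), X.germToFunctionField U a = h := by
  choose V hVU hxV _ b hb using fun x : U ↦ exists_le_germToFunctionField_eq x.2 (hh x x.2)
  have hcompat : X.presheaf.IsCompatible V b := fun x y ↦ by
    have : Nonempty (V x ⊓ V y : X.Opens) :=
      (nonempty_preirreducible_inter (V x).2 (V y).2 ⟨x, hxV x⟩ ⟨y, hxV y⟩).to_subtype
    apply X.germToFunctionField_injective (V x ⊓ V y)
    rw [germToFunctionField_res, germToFunctionField_res, hb, hb]
  obtain ⟨a, ha, -⟩ : ∃! a : Γ(X, U), ∀ x, X.presheaf.map (homOfLE (hVU x)).op a = b x :=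
    X.sheaf.existsUnique_gluing' V U (fun x ↦ homOfLE (hVU x))
      (fun x hx ↦ Opens.mem_iSup.mpr ⟨⟨x, hx⟩, hxV _⟩) b hcompat
  obtain ⟨x : U⟩ := ‹Nonempty U›
  exact ⟨a, by rw [← germToFunctionField_res (homOfLE (hVU x)), ha, hb]⟩

/-- `Γ(D(s), 𝒪) = Γ(U, 𝒪)[1/s]`, read in the function field. -/
theorem exists_germToFunctionField_eq_pow_mul {U : X.Opens} [Nonempty U] (hU : IsAffineOpen U)
    (s : Γ(X, U)) {h : X.functionField} (hh : ∀ x ∈ X.basicOpen s, h ∈ stalkSubring X x) :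
    ∃ (N : ℕ) (a : Γ(X, U)),
      X.germToFunctionField U a = X.germToFunctionField U s ^ N * h := by
  obtain rfl | hs := eq_or_ne s 0
  · exact ⟨1, 0, by simp⟩
  have : Nonempty (X.basicOpen s) :=
    ((Opens.ne_bot_iff_nonempty _).mp (by rwa [Ne, basicOpen_eq_bot_iff])).to_subtype
  obtain ⟨c, rfl⟩ := exists_germToFunctionField_eq hh
  have := hU.isLocalization_basicOpen s
  obtain ⟨⟨a, _, N, rfl⟩, hc⟩ := IsLocalization.surj (Submonoid.powers s) c
  have hres (b : Γ(X, U)) : X.germToFunctionField (X.basicOpen s)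
      (algebraMap Γ(X, U) Γ(X, X.basicOpen s) b) = X.germToFunctionField U b :=
    germToFunctionField_res (homOfLE (X.basicOpen_le s)) b
  refine ⟨N, a, ?_⟩
  rw [← hres a, ← hc, map_mul, hres, map_pow, mul_comm]

theorem isSectionAt_iff {D : CartierDivisor X} {x : X} {e : (X.functionField)ˣ}
    (he : QuotientGroup.mk e = germAt D x) (g : X.functionField) :
    IsSectionAt D g x ↔ e * g ∈ stalkSubring X x := by
  constructor
  · rintro ⟨e', a, he', hag⟩
    obtain ⟨c, hc⟩ := QuotientGroup.eq.mp (he'.trans he.symm)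
    have hc' : algebraMap (X.presheaf.stalk x) X.functionField c =
        (e' : X.functionField)⁻¹ * e := by
      simpa using congrArg Units.val hc
    refine ⟨c * a, ?_⟩
    rw [map_mul, hc', hag]
    field_simp
  · rintro ⟨a, ha⟩
    exact ⟨e, a, he, ha⟩

theorem isNonvanishingAt_iff_isUnit {D : CartierDivisor X} {g : X.functionField} {x : X}
    {e : (X.functionField)ˣ} (he : QuotientGroup.mk e = germAt D x) {a : X.presheaf.stalk x}
    (ha : algebraMap (X.presheaf.stalk x) X.functionField a = e * g) :
    IsNonvanishingAt D g x ↔ IsUnit a := by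
  rw [isNonvanishingAt_iff D g x e he]
  constructor
  · rintro ⟨b, hb, hbg⟩
    rwa [IsFractionRing.injective (X.presheaf.stalk x) X.functionField (ha.trans hbg.symm)]
  · exact fun h ↦ ⟨a, h, ha⟩

theorem mk_mul_eq_germAt_add {D F : CartierDivisor X} {x : X} {e e' : (X.functionField)ˣ}
    (he : QuotientGroup.mk e = germAt D x) (he' : QuotientGroup.mk e' = germAt F x) :
    QuotientGroup.mk (e * e') = germAt (D + F) x := by
  rw [QuotientGroup.mk_mul, he, he']
  rfl

theorem IsSectionAt.mul {D F : CartierDivisor X} {g h : X.functionField} {x : X}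
    (hg : IsSectionAt D g x) (hh : IsSectionAt F h x) : IsSectionAt (D + F) (g * h) x := by
  obtain ⟨e, a, he, ha⟩ := hg
  obtain ⟨e', a', he', ha'⟩ := hh
  refine ⟨e * e', a * a', mk_mul_eq_germAt_add he he', ?_⟩
  rw [map_mul, ha, ha', Units.val_mul, mul_mul_mul_comm]

theorem IsSectionAt.pow {D : CartierDivisor X} {g : X.functionField} {x : X}
    (hg : IsSectionAt D g x) (n : ℕ) : IsSectionAt (n • D) (g ^ n) x := by
  obtain ⟨e, a, he, ha⟩ := hg
  refine ⟨e ^ n, a ^ n, mk_eq_germAt_nsmul he n, ?_⟩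
  rw [map_pow, ha, mul_pow, Units.val_pow_eq_pow_val]

theorem IsNonvanishingAt.isSectionAt {D : CartierDivisor X} {g : X.functionField} {x : X}
    (hg : IsNonvanishingAt D g x) : IsSectionAt D g x := by
  obtain ⟨e, a, he, -, ha⟩ := hg
  exact ⟨e, a, he, ha⟩

theorem IsNonvanishingAt.mul {D F : CartierDivisor X} {g h : X.functionField} {x : X}
    (hg : IsNonvanishingAt D g x) (hh : IsNonvanishingAt F h x) :
    IsNonvanishingAt (D + F) (g * h) x := by
  obtain ⟨e, a, he, hu, ha⟩ := hg
  obtain ⟨e', a', he', hu', ha'⟩ := hh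
  refine ⟨e * e', a * a', mk_mul_eq_germAt_add he he', hu.mul hu', ?_⟩
  rw [map_mul, ha, ha', Units.val_mul, mul_mul_mul_comm]

theorem IsNonvanishingAt.pow {D : CartierDivisor X} {g : X.functionField} {x : X}
    (hg : IsNonvanishingAt D g x) (n : ℕ) : IsNonvanishingAt (n • D) (g ^ n) x := by
  obtain ⟨e, a, he, hu, ha⟩ := hg
  refine ⟨e ^ n, a ^ n, mk_eq_germAt_nsmul he n, hu.pow n, ?_⟩
  rw [map_pow, ha, mul_pow, Units.val_pow_eq_pow_val]

theorem isNonvanishingAt_inv {D : CartierDivisor X} {x : X} {e : (X.functionField)ˣ}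
    (he : QuotientGroup.mk e = germAt D x) : IsNonvanishingAt D (e⁻¹ : X.functionField) x :=
  ⟨e, 1, he, isUnit_one, by simp⟩

theorem isSectionAt_zero_germToFunctionField {U : X.Opens} [Nonempty U] {x : X} (hx : x ∈ U)
    (s : Γ(X, U)) : IsSectionAt 0 (X.germToFunctionField U s) x :=
  ⟨1, X.presheaf.germ U x hx s, rfl, by
    rw [Scheme.algebraMap_germ_eq_germToFunctionField, Units.val_one, one_mul]⟩

theorem isNonvanishingAt_zero_germToFunctionField_iff {U : X.Opens} [Nonempty U] {x : X}
    (hx : x ∈ U) (s : Γ(X, U)) :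
    IsNonvanishingAt 0 (X.germToFunctionField U s) x ↔ x ∈ X.basicOpen s := by
  rw [X.mem_basicOpen s x hx]
  refine isNonvanishingAt_iff_isUnit (e := 1) rfl ?_
  rw [Scheme.algebraMap_germ_eq_germToFunctionField, Units.val_one, one_mul]

/-! ### Extension of sections -/

theorem exists_isAffineOpen_forall_mk_eq_germAt (D : CartierDivisor X) {x : X} {W : X.Opens}
    (hW : x ∈ W) : ∃ U : X.Opens, IsAffineOpen U ∧ x ∈ U ∧ U ≤ W ∧
      ∃ e : (X.functionField)ˣ, ∀ y ∈ U, QuotientGroup.mk e = germAt D y := by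
  obtain ⟨V, hxV, e, he⟩ := D.toMul.2 x
  obtain ⟨_, ⟨U, hU, rfl⟩, hxU, hUV⟩ :=
    X.isBasis_affineOpens.exists_subset_of_mem_open (show x ∈ V ⊓ W from ⟨hxV, hW⟩) (V ⊓ W).isOpen
  exact ⟨U, hU, hxU, fun y hy ↦ (hUV hy).2, e, fun y hy ↦ (he y (hUV hy).1).symm⟩

theorem exists_forall_isSectionAt_of_isAffineOpen {U : X.Opens} [Nonempty U] (hU : IsAffineOpen U)
    {D F : CartierDivisor X} {e e' : (X.functionField)ˣ}
    (he : ∀ y ∈ U, QuotientGroup.mk e = germAt D y)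
    (he' : ∀ y ∈ U, QuotientGroup.mk e' = germAt F y) {g h : X.functionField}
    (hg : ∀ y ∈ U, IsSectionAt D g y) (hh : ∀ y ∈ U, IsNonvanishingAt D g y → IsSectionAt F h y) :
    ∃ N : ℕ, ∀ y ∈ U, IsSectionAt (N • D + F) (g ^ N * h) y := by
  obtain ⟨s, hs⟩ := exists_germToFunctionField_eq fun y hy ↦
    (isSectionAt_iff (he y hy) g).mp (hg y hy)
  obtain ⟨N, a, ha⟩ := exists_germToFunctionField_eq_pow_mul hU s (h := e' * h) fun y hy ↦ by
    have hyU := X.basicOpen_le s hy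
    refine (isSectionAt_iff (he' y hyU) h).mp (hh y hyU ?_)
    refine (isNonvanishingAt_iff_isUnit (he y hyU) ?_).mpr ((X.mem_basicOpen s y hyU).mp hy)
    rw [Scheme.algebraMap_germ_eq_germToFunctionField, hs]
  refine ⟨N, fun y hy ↦ (isSectionAt_iff
    (mk_mul_eq_germAt_add (mk_eq_germAt_nsmul (he y hy) N) (he' y hy)) _).mpr ?_⟩
  convert germToFunctionField_mem_stalkSubring hy a using 1
  rw [ha, hs, Units.val_mul, Units.val_pow_eq_pow_val, mul_mul_mul_comm, mul_pow]

theorem exists_forall_isSectionAt_pow_mul {V : X.Opens} (hV : IsCompact (V : Set X))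
    {D F : CartierDivisor X} {g h : X.functionField} (hg : ∀ x ∈ V, IsSectionAt D g x)
    (hh : ∀ x ∈ V, IsNonvanishingAt D g x → IsSectionAt F h x) :
    ∃ N : ℕ, ∀ x ∈ V, IsSectionAt (N • D + F) (g ^ N * h) x := by
  have hloc (x : X) (hx : x ∈ V) : ∃ U : X.Opens, x ∈ U ∧ ∃ N : ℕ, ∀ y ∈ U,
      IsSectionAt (N • D + F) (g ^ N * h) y := by
    obtain ⟨W, -, hxW, hWV, e, he⟩ := exists_isAffineOpen_forall_mk_eq_germAt D hx
    obtain ⟨U, hU, hxU, hUW, e', he'⟩ := exists_isAffineOpen_forall_mk_eq_germAt F hxW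
    have : Nonempty U := ⟨⟨x, hxU⟩⟩
    exact ⟨U, hxU, exists_forall_isSectionAt_of_isAffineOpen hU
      (fun y hy ↦ he y (hUW hy)) he' (fun y hy ↦ hg y (hWV (hUW hy)))
      fun y hy ↦ hh y (hWV (hUW hy))⟩
  choose! U hxU N hN using hloc
  obtain ⟨t, htV, ht⟩ := hV.elim_nhds_subcover (fun x ↦ (U x : Set X))
    fun x hx ↦ (U x).isOpen.mem_nhds (hxU x hx)
  refine ⟨t.sup N, fun y hy ↦ ?_⟩
  obtain ⟨x, hxt, hyx⟩ := Set.mem_iUnion₂.mp (ht hy)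
  obtain ⟨d, hd⟩ := Nat.exists_eq_add_of_le' (Finset.le_sup (f := N) hxt)
  rw [hd, add_smul, pow_add, add_assoc, mul_assoc]
  exact ((hg y hy).pow d).mul (hN x (htV x hxt) y hyx)

theorem exists_isNonvanishingAt_of_isAffineOpen {V : X.Opens} (hV : IsAffineOpen V)
    (F : CartierDivisor X) {x : X} (hx : x ∈ V) :
    ∃ h : X.functionField, (∀ y ∈ V, IsSectionAt F h y) ∧ IsNonvanishingAt F h x := by
  obtain ⟨U, -, hxU, -, e, he⟩ := exists_isAffineOpen_forall_mk_eq_germAt F hx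
  obtain ⟨s, hsU, hxs⟩ := hV.exists_basicOpen_le ⟨x, hxU⟩ hx
  have : Nonempty V := ⟨⟨x, hx⟩⟩
  obtain ⟨N, hN⟩ := exists_forall_isSectionAt_pow_mul hV.isCompact
    (fun y hy ↦ isSectionAt_zero_germToFunctionField hy s) fun y hy hys ↦
      (isNonvanishingAt_inv (he y (hsU
        ((isNonvanishingAt_zero_germToFunctionField_iff hy s).mp hys)))).isSectionAt
  have hxN := (((isNonvanishingAt_zero_germToFunctionField_iff hx s).mpr hxs).pow N).mul
    (isNonvanishingAt_inv (he x hxU))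
  rw [smul_zero, zero_add] at hN hxN
  exact ⟨_, hN, hxN⟩

theorem notMem_baseLocus_iff {L : CartierDivisor X} {x : X} :
    x ∉ baseLocus L ↔ ∃ g ∈ globalSections L, IsNonvanishingAt L g x := by
  change ¬ (∀ g ∈ globalSections L, ¬ IsNonvanishingAt L g x) ↔ _
  push Not
  rfl

theorem IsAmple.exists_notMem_baseLocus {A : CartierDivisor X} (hA : IsAmple A)
    (F : CartierDivisor X) (x : X) : ∃ q : ℕ, 0 < q ∧ x ∉ baseLocus (q • A + F) := by
  have := hA.1
  obtain ⟨n, hn, g, hg, hxg, haff⟩ := hA.2 x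
  obtain ⟨h, hh, hxh⟩ := exists_isNonvanishingAt_of_isAffineOpen haff F hxg
  obtain ⟨N, hN⟩ := exists_forall_isSectionAt_pow_mul (V := ⊤) isCompact_univ
    (fun y _ ↦ hg y) fun y _ hy ↦ hh y hy
  refine ⟨(N + 1) * n, by positivity, notMem_baseLocus_iff.mpr ⟨g ^ (N + 1) * h, fun y ↦ ?_, ?_⟩⟩
  · rw [mul_smul, succ_nsmul', pow_succ', add_assoc, mul_assoc]
    exact (hg y).mul (hN y trivial)
  · rw [mul_smul]
    exact (hxg.pow (N + 1)).mul hxh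

end Sections

/-! ### Semiampleness at a point and augmented base loci -/

section StableBaseLocus

variable {X : Scheme.{u}} [IsIntegral X]

theorem notMem_iInf_pos_iff {α : Type*} [TopologicalSpace α] {Z : ℕ → Closeds α} {x : α} :
    x ∉ ⨅ (m : ℕ) (_ : 0 < m), Z m ↔ ∃ m : ℕ, 0 < m ∧ x ∉ Z m := by
  simp only [← SetLike.mem_coe, Closeds.coe_iInf, Set.mem_iInter, not_forall, exists_prop]

theorem notMem_stableBaseSet_iff {L : CartierDivisor X} {x : X} :
    x ∉ stableBaseSet L ↔ ∃ m : ℕ, 0 < m ∧ x ∉ baseLocus (m • L) :=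
  notMem_iInf_pos_iff

theorem notMem_stableBaseSet_of_notMem_baseLocus {L : CartierDivisor X} {x : X}
    (h : x ∉ baseLocus L) : x ∉ stableBaseSet L :=
  notMem_stableBaseSet_iff.mpr ⟨1, one_pos, by rwa [one_smul]⟩

theorem notMem_baseLocus_add {L F : CartierDivisor X} {x : X} (hL : x ∉ baseLocus L)
    (hF : x ∉ baseLocus F) : x ∉ baseLocus (L + F) := by
  rw [notMem_baseLocus_iff] at *
  obtain ⟨g, hg, hgx⟩ := hL
  obtain ⟨h, hh, hhx⟩ := hF
  exact ⟨g * h, fun y ↦ (hg y).mul (hh y), hgx.mul hhx⟩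

theorem notMem_stableBaseSet_add {L F : CartierDivisor X} {x : X} (hL : x ∉ stableBaseSet L)
    (hF : x ∉ stableBaseSet F) : x ∉ stableBaseSet (L + F) := by
  obtain ⟨m, hm, hmx⟩ := notMem_stableBaseSet_iff.mp hL
  obtain ⟨n, hn, hnx⟩ := notMem_stableBaseSet_iff.mp hF
  refine notMem_stableBaseSet_iff.mpr ⟨n * m, Nat.mul_pos hn hm, ?_⟩
  rw [smul_add]
  refine notMem_baseLocus_add (fun h ↦ hmx ?_) fun h ↦ hnx ?_
  · rw [mul_smul] at h
    exact baseLocus_nsmul_le _ n h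
  · rw [mul_comm, mul_smul] at h
    exact baseLocus_nsmul_le _ m h

theorem notMem_stableBaseSet_principal (g : (X.functionField)ˣ) (x : X) :
    x ∉ stableBaseSet (principal g) :=
  notMem_stableBaseSet_of_notMem_baseLocus <| notMem_baseLocus_iff.mpr
    ⟨_, fun _ ↦ (isNonvanishingAt_inv rfl).isSectionAt, isNonvanishingAt_inv (e := g) rfl⟩

theorem IsAmple.notMem_stableBaseSet {A : CartierDivisor X} (hA : IsAmple A) (x : X) :
    x ∉ stableBaseSet A := by
  obtain ⟨q, hq, hx⟩ := hA.exists_notMem_baseLocus 0 x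
  exact notMem_stableBaseSet_iff.mpr ⟨q, hq, by rwa [add_zero] at hx⟩

/-- The monoid of Cartier divisors that are semiample at `x`: some positive multiple has a global
section that does not vanish at `x`. -/
def semiampleAt (x : X) : AddSubmonoid (CartierDivisor X) where
  carrier := {L | x ∉ stableBaseSet L}
  zero_mem' := notMem_stableBaseSet_principal 1 x
  add_mem' := notMem_stableBaseSet_add

/-- The convex cone in `Div(X) ⊗ ℝ` generated by the Cartier divisors that are semiample at `x`. -/
def semiampleCone (x : X) : PointedCone ℝ (RDivisor X) :=
  PointedCone.hull ℝ ((1 ⊗ₜ[ℤ] ·) '' (semiampleAt x : Set (CartierDivisor X)))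

theorem one_tmul_mem_semiampleCone_iff {L : CartierDivisor X} {x : X} :
    1 ⊗ₜ[ℤ] L ∈ semiampleCone x ↔ x ∉ stableBaseSet L :=
  ⟨mem_of_one_tmul_mem_hull_real (C := semiampleAt x)
    fun n hn L hL hLx ↦ hL (by rwa [stableBaseSet_nsmul L hn]),
    fun h ↦ Submodule.subset_span ⟨L, h, rfl⟩⟩

theorem tmul_mem_semiampleCone {L : CartierDivisor X} {x : X} {r : ℝ} (hr : 0 ≤ r)
    (hL : x ∉ stableBaseSet L) : r ⊗ₜ[ℤ] L ∈ semiampleCone x := by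
  rw [← mul_one r, ← smul_eq_mul, ← TensorProduct.smul_tmul']
  exact PointedCone.smul_mem _ hr (one_tmul_mem_semiampleCone_iff.mpr hL)

theorem RLinearEquiv.symm {Δ Δ' : RDivisor X} (h : RLinearEquiv Δ Δ') : RLinearEquiv Δ' Δ := by
  rw [RLinearEquiv, ← neg_sub]
  exact Submodule.neg_mem _ h

theorem RLinearEquiv.trans {Δ Δ' Δ'' : RDivisor X} (h : RLinearEquiv Δ Δ')
    (h' : RLinearEquiv Δ' Δ'') : RLinearEquiv Δ Δ'' := by
  rw [RLinearEquiv, ← sub_add_sub_cancel]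
  exact Submodule.add_mem _ h h'

theorem RLinearEquiv.sub_mem_semiampleCone {Δ Δ' : RDivisor X} (h : RLinearEquiv Δ Δ') (x : X) :
    Δ - Δ' ∈ semiampleCone x := by
  have hle : Submodule.span ℝ (Set.range fun g : (X.functionField)ˣ ↦ (1 : ℝ) ⊗ₜ[ℤ] principal g) ≤
      (semiampleCone x).lineal := by
    rw [Submodule.span_le]
    rintro _ ⟨g, rfl⟩
    refine PointedCone.mem_lineal.mpr ⟨one_tmul_mem_semiampleCone_iff.mpr
      (notMem_stableBaseSet_principal g x), ?_⟩
    rw [← TensorProduct.tmul_neg]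
    exact one_tmul_mem_semiampleCone_iff.mpr (notMem_stableBaseSet_principal g⁻¹ x)
  exact PointedCone.lineal_le _ (hle h)

variable {ι ι' : Type*} [Fintype ι] [Fintype ι']

/-- The closed set `⋂_{m ≥ 1} 𝐁(∑ ⌊m tᵢ⌋ Bᵢ - A)` underlying the augmented base locus of
`∑ tᵢ Bᵢ`. -/
def augmentedBaseSet (A : CartierDivisor X) (t : ι → ℝ) (B : ι → CartierDivisor X) : Closeds X :=
  ⨅ (m : ℕ) (_ : 0 < m), stableBaseSet ((∑ i, ⌊(m : ℝ) * t i⌋ • B i) - A)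

theorem one_tmul_sum_floor_smul (t : ι → ℝ) (B : ι → CartierDivisor X) (a : ℝ) :
    (1 : ℝ) ⊗ₜ[ℤ] ∑ i, ⌊a * t i⌋ • B i =
      a • ∑ i, t i ⊗ₜ[ℤ] B i - ∑ i, Int.fract (a * t i) ⊗ₜ[ℤ] B i := by
  rw [TensorProduct.tmul_sum, Finset.smul_sum, ← Finset.sum_sub_distrib]
  refine Finset.sum_congr rfl fun i _ ↦ ?_
  rw [← TensorProduct.smul_tmul, zsmul_one, TensorProduct.smul_tmul', smul_eq_mul,
    ← TensorProduct.sub_tmul, Int.self_sub_fract]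

theorem exists_sub_smul_mem_semiampleCone {A : CartierDivisor X} {t : ι → ℝ}
    {B : ι → CartierDivisor X} {x : X} (hB : ∀ i, x ∉ stableBaseSet (B i))
    (hx : x ∉ augmentedBaseSet A t B) :
    ∃ ε : ℝ, 0 < ε ∧ ∑ i, t i ⊗ₜ[ℤ] B i - ε • (1 ⊗ₜ[ℤ] A) ∈ semiampleCone x := by
  obtain ⟨m, hm, hmx⟩ := notMem_iInf_pos_iff.mp hx
  have hm' : (0 : ℝ) < m := Nat.cast_pos.mpr hm
  refine ⟨(m : ℝ)⁻¹, inv_pos.mpr hm', ?_⟩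
  refine ((semiampleCone x).smul_mem_iff hm').mp ?_
  rw [smul_sub, smul_inv_smul₀ hm'.ne']
  have hfract := sum_mem fun i (_ : i ∈ Finset.univ) ↦
    tmul_mem_semiampleCone (Int.fract_nonneg ((m : ℝ) * t i)) (hB i)
  convert add_mem (one_tmul_mem_semiampleCone_iff.mpr hmx) hfract using 1
  rw [TensorProduct.tmul_sub, one_tmul_sum_floor_smul]
  abel

theorem notMem_augmentedBaseSet_of_sub_smul_mem {A : CartierDivisor X} (hA : IsAmple A) {t : ι → ℝ}
    {B : ι → CartierDivisor X} {x : X} (hB : ∀ i, x ∉ stableBaseSet (B i)) {ε : ℝ} (hε : 0 < ε)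
    (hx : ∑ i, t i ⊗ₜ[ℤ] B i - ε • (1 ⊗ₜ[ℤ] A) ∈ semiampleCone x) :
    x ∉ augmentedBaseSet A t B := by
  obtain ⟨q, -, hqx⟩ := hA.exists_notMem_baseLocus (-A - ∑ i, B i) x
  obtain ⟨m, hm⟩ := exists_nat_gt (q / ε)
  have hqm : q < m * ε := (div_lt_iff₀ hε).mp hm
  have hm0 : 0 < m := Nat.cast_pos.mp ((div_nonneg q.cast_nonneg hε.le).trans_lt hm)
  refine notMem_iInf_pos_iff.mpr ⟨m, hm0, one_tmul_mem_semiampleCone_iff.mp ?_⟩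
  have hΔ := PointedCone.smul_mem _ m.cast_nonneg hx
  have hA' := PointedCone.smul_mem _ (sub_nonneg.mpr hqm.le)
    (one_tmul_mem_semiampleCone_iff.mpr (hA.notMem_stableBaseSet x))
  have hq := one_tmul_mem_semiampleCone_iff.mpr (notMem_stableBaseSet_of_notMem_baseLocus hqx)
  have hfract := sum_mem fun i (_ : i ∈ Finset.univ) ↦
    tmul_mem_semiampleCone (sub_nonneg.mpr (Int.fract_lt_one ((m : ℝ) * t i)).le) (hB i)
  convert add_mem (add_mem hΔ hA') (add_mem hq hfract) using 1
  rw [TensorProduct.tmul_sub, one_tmul_sum_floor_smul]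
  simp only [TensorProduct.tmul_sub, TensorProduct.tmul_add, TensorProduct.tmul_neg,
    TensorProduct.tmul_smul, TensorProduct.sub_tmul, Finset.sum_sub_distrib,
    TensorProduct.tmul_sum]
  module

theorem augmentedBaseSet_le {A A' : CartierDivisor X} (hA : IsAmple A) (hA' : IsAmple A')
    {t : ι → ℝ} {t' : ι' → ℝ} {B : ι → CartierDivisor X} {B' : ι' → CartierDivisor X}
    (hB : ∀ i x, x ∉ stableBaseSet (B i)) (hB' : ∀ i x, x ∉ stableBaseSet (B' i))
    (h : RLinearEquiv (∑ i, t i ⊗ₜ[ℤ] B i) (∑ i, t' i ⊗ₜ[ℤ] B' i)) :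
    augmentedBaseSet A t B ≤ augmentedBaseSet A' t' B' := by
  intro x
  contrapose
  intro hx
  obtain ⟨ε, hε, hx'⟩ := exists_sub_smul_mem_semiampleCone (hB' · x) hx
  obtain ⟨q, hq, hqx⟩ := hA'.exists_notMem_baseLocus (-A) x
  have hq' : (0 : ℝ) < q := Nat.cast_pos.mpr hq
  refine notMem_augmentedBaseSet_of_sub_smul_mem hA (hB · x) (div_pos hε hq') ?_
  have hAA' := PointedCone.smul_mem _ (div_pos hε hq').le
    (one_tmul_mem_semiampleCone_iff.mpr (notMem_stableBaseSet_of_notMem_baseLocus hqx))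
  convert add_mem (add_mem (h.sub_mem_semiampleCone x) hx') hAA' using 1
  rw [TensorProduct.tmul_add, TensorProduct.tmul_smul, TensorProduct.tmul_neg]
  match_scalars <;> field_simp <;> ring

theorem augmentedBaseSet_eq {A A' : CartierDivisor X} (hA : IsAmple A) (hA' : IsAmple A')
    {t : ι → ℝ} {t' : ι' → ℝ} {B : ι → CartierDivisor X} {B' : ι' → CartierDivisor X}
    (hB : ∀ i x, x ∉ stableBaseSet (B i)) (hB' : ∀ i x, x ∉ stableBaseSet (B' i))
    (h : RLinearEquiv (∑ i, t i ⊗ₜ[ℤ] B i) (∑ i, t' i ⊗ₜ[ℤ] B' i)) :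
    augmentedBaseSet A t B = augmentedBaseSet A' t' B' :=
  (augmentedBaseSet_le hA hA' hB hB' h).antisymm (augmentedBaseSet_le hA' hA hB' hB h.symm)

end StableBaseLocus

section Pullback

variable {X Y : Scheme.{u}} [IsIntegral X] [IsIntegral Y] (f : X ⟶ Y) [IsDominant f]

theorem mk_map_eq_germAt_pullbackCartier {D : CartierDivisor Y} {x : X}
    {e : (Y.functionField)ˣ} (he : QuotientGroup.mk e = germAt D (f x)) :
    QuotientGroup.mk (Units.map (functionFieldMap f : Y.functionField →* X.functionField) e) =
      germAt (pullbackCartier f D) x :=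
  congrArg (pullbackGerm f x) he

theorem IsSectionAt.pullback {D : CartierDivisor Y} {g : Y.functionField} {x : X}
    (hg : IsSectionAt D g (f x)) :
    IsSectionAt (pullbackCartier f D) (functionFieldMap f g) x := by
  obtain ⟨e, a, he, ha⟩ := hg
  refine ⟨_, f.stalkMap x a, mk_map_eq_germAt_pullbackCartier f he, ?_⟩
  rw [← functionFieldMap_algebraMap, ha, map_mul]
  rfl

theorem isNonvanishingAt_pullback_iff {D : CartierDivisor Y} {g : Y.functionField} {x : X}
    (hg : IsSectionAt D g (f x)) :
    IsNonvanishingAt (pullbackCartier f D) (functionFieldMap f g) x ↔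
      IsNonvanishingAt D g (f x) := by
  obtain ⟨e, a, he, ha⟩ := hg
  have ha' : algebraMap (X.presheaf.stalk x) X.functionField (f.stalkMap x a) =
      functionFieldMap f e * functionFieldMap f g := by
    rw [← functionFieldMap_algebraMap, ha, map_mul]
  rw [isNonvanishingAt_iff_isUnit he ha,
    isNonvanishingAt_iff_isUnit (mk_map_eq_germAt_pullbackCartier f he) ha']
  exact isUnit_map_iff (f.stalkMap x).hom a

theorem IsAmple.pullback [IsAffineHom f] {A : CartierDivisor Y} (hA : IsAmple A) :
    IsAmple (pullbackCartier f A) := by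
  have := hA.1
  refine ⟨QuasiCompact.compactSpace_of_compactSpace f, fun x ↦ ?_⟩
  obtain ⟨n, hn, g, hg, hx, haff⟩ := hA.2 (f x)
  have hlocus : nonvanishingLocus (pullbackCartier f (n • A)) (functionFieldMap f g) =
      f ⁻¹ᵁ nonvanishingLocus (n • A) g :=
    Opens.ext <| Set.ext fun y ↦ isNonvanishingAt_pullback_iff f (hg (f y))
  refine ⟨n, hn, functionFieldMap f g, ?_⟩
  rw [← map_nsmul, hlocus]
  exact ⟨fun y ↦ (hg (f y)).pullback f, hx, haff.preimage f⟩

theorem functionFieldMap_germToFunctionField (V : Y.Opens) [Nonempty V] [Nonempty (f ⁻¹ᵁ V)]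
    (a : Γ(Y, V)) : functionFieldMap f (Y.germToFunctionField V a) =
      X.germToFunctionField (f ⁻¹ᵁ V) (f.app V a) := by
  obtain ⟨x, hx⟩ := ‹Nonempty (f ⁻¹ᵁ V)›
  rw [← Scheme.algebraMap_germ_eq_germToFunctionField Y (x := f x) hx,
    functionFieldMap_algebraMap, ← Scheme.algebraMap_germ_eq_germToFunctionField X hx]
  exact congrArg _ (Scheme.Hom.germ_stalkMap_apply f V x hx a)

theorem notMem_baseLocus_pullback {L : CartierDivisor Y} {x : X} (h : f x ∉ baseLocus L) :
    x ∉ baseLocus (pullbackCartier f L) := by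
  obtain ⟨g, hg, hgx⟩ := notMem_baseLocus_iff.mp h
  exact notMem_baseLocus_iff.mpr ⟨functionFieldMap f g, fun y ↦ (hg (f y)).pullback f,
    (isNonvanishingAt_pullback_iff f (hg (f x))).mpr hgx⟩

theorem RLinearEquiv.pullback {Δ Δ' : RDivisor Y} (h : RLinearEquiv Δ Δ') :
    RLinearEquiv (pullbackR f Δ) (pullbackR f Δ') := by
  rw [RLinearEquiv, ← map_sub]
  have hmap := Submodule.mem_map_of_mem (f := pullbackR f) h
  rw [Submodule.map_span] at hmap
  refine Submodule.span_mono ?_ hmap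
  rintro _ ⟨_, ⟨g, rfl⟩, rfl⟩
  exact ⟨Units.map (functionFieldMap f : Y.functionField →* X.functionField) g, rfl⟩

end Pullback

/-! ### Descent along integral morphisms -/

section Descent

open Polynomial

theorem coeff_minpoly_mul_pow_mem_range {A K L : Type*} [CommRing A] [IsDomain A]
    [IsIntegrallyClosed A] [Field K] [Algebra A K] [IsFractionRing A K] [Field L] [Algebra K L]
    [Algebra A L] [IsScalarTower A K L] {e : K} (he : e ≠ 0) {θ : L}
    (hθ : _root_.IsIntegral K θ) (h : _root_.IsIntegral A (e • θ)) (i : ℕ) :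
    (minpoly K θ).coeff i * e ^ ((minpoly K θ).natDegree - i) ∈ (algebraMap A K).range := by
  rw [← coeff_scaleRoots, ← IsIntegrallyClosed.minpoly_smul he hθ,
    minpoly.isIntegrallyClosed_eq_field_fractions' K h, coeff_map]
  exact ⟨_, rfl⟩

theorem exists_isUnit_coeff_of_isUnit_root {A B : Type*} [CommRing A] [IsLocalRing A]
    [CommRing B] [IsLocalRing B] (φ : A →+* B) [IsLocalHom φ] {p : A[X]} (hp : p.Monic)
    {u : B} (hu : IsUnit u) (h : p.eval₂ φ u = 0) :
    ∃ i < p.natDegree, IsUnit (p.coeff i) := by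
  by_contra! hcoeff
  have hlower : ∑ i ∈ Finset.range p.natDegree, φ (p.coeff i) * u ^ i ∈
      IsLocalRing.maximalIdeal B :=
    Ideal.sum_mem _ fun i hi ↦ Ideal.mul_mem_right _ _ <|
      (map_mem_nonunits_iff φ _).mpr (hcoeff i (Finset.mem_range.mp hi))
  rw [eval₂_eq_sum_range, Finset.sum_range_succ, hp.coeff_natDegree, map_one, one_mul] at h
  have hpow : u ^ p.natDegree ∈ IsLocalRing.maximalIdeal B := by
    rw [eq_neg_of_add_eq_zero_right h]
    exact neg_mem hlower
  exact hpow (hu.pow _)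

variable {X Y : Scheme.{u}} [IsIntegral X] [IsIntegral Y] (f : X ⟶ Y) [IsDominant f]

theorem exists_isIntegralElem_mul [IsIntegralHom f] {D : CartierDivisor Y}
    {g : X.functionField} (hg : g ∈ globalSections (pullbackCartier f D)) (y : Y) :
    ∃ e : (Y.functionField)ˣ, QuotientGroup.mk e = germAt D y ∧
      ((functionFieldMap f).comp
        (algebraMap (Y.presheaf.stalk y) Y.functionField)).IsIntegralElem
          (functionFieldMap f e * g) := by
  obtain ⟨V, hV, hyV, -, e, he⟩ := exists_isAffineOpen_forall_mk_eq_germAt D (W := ⊤) (x := y)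
    trivial
  have : Nonempty V := ⟨⟨y, hyV⟩⟩
  have : Nonempty (f ⁻¹ᵁ V) :=
    let ⟨x, hx⟩ := f.denseRange.exists_mem_open V.isOpen ⟨y, hyV⟩
    ⟨⟨x, hx⟩⟩
  obtain ⟨b, hb⟩ := exists_germToFunctionField_eq (U := f ⁻¹ᵁ V) fun x hx ↦
    (isSectionAt_iff (mk_map_eq_germAt_pullbackCartier f (he (f x) hx)) g).mp (hg x)
  replace hb : X.germToFunctionField (f ⁻¹ᵁ V) b = functionFieldMap f e * g := hb
  refine ⟨e, he y hyV, ?_⟩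
  obtain ⟨p, hp, hpb⟩ := f.isIntegral_app V hV b
  have hcomp : ((functionFieldMap f).comp (algebraMap (Y.presheaf.stalk y) Y.functionField)).comp
      (Y.presheaf.germ V y hyV).hom =
        (X.germToFunctionField (f ⁻¹ᵁ V)).hom.comp (f.app V).hom := by
    ext a
    refine Eq.trans ?_ (functionFieldMap_germToFunctionField f V a)
    exact congrArg (functionFieldMap f) (Scheme.algebraMap_germ_eq_germToFunctionField Y hyV a)
  refine ⟨p.map (Y.presheaf.germ V y hyV).hom, hp.map _, ?_⟩
  rw [eval₂_map, hcomp, ← hb, ← hom_eval₂, hpb, map_zero]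

theorem exists_monic_coeff_mem_globalSections [IsIntegralHom f] [IsNormalScheme Y]
    {D : CartierDivisor Y} {g : X.functionField} (hg : g ∈ globalSections (pullbackCartier f D)) :
    ∃ P : Y.functionField[X], P.Monic ∧ P.eval₂ (functionFieldMap f) g = 0 ∧
      ∀ i, P.coeff i ∈ globalSections ((P.natDegree - i) • D) := by
  let : Algebra Y.functionField X.functionField := (functionFieldMap f).toAlgebra
  have hint : _root_.IsIntegral Y.functionField g := by
    obtain ⟨e, -, h⟩ := exists_isIntegralElem_mul f hg (genericPoint Y)
    have h' : _root_.IsIntegral Y.functionField ((e : Y.functionField) • g) :=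
      RingHom.IsIntegralElem.of_comp h
    simpa using h'.smul (e⁻¹ : Y.functionField)
  refine ⟨minpoly Y.functionField g, minpoly.monic hint, minpoly.aeval _ _, fun i y ↦ ?_⟩
  let : Algebra (Y.presheaf.stalk y) X.functionField :=
    ((functionFieldMap f).comp (algebraMap (Y.presheaf.stalk y) Y.functionField)).toAlgebra
  have : IsScalarTower (Y.presheaf.stalk y) Y.functionField X.functionField :=
    .of_algebraMap_eq fun _ ↦ rfl
  have := IsNormalScheme.isIntegrallyClosed_stalk y
  obtain ⟨e, he, h⟩ := exists_isIntegralElem_mul f hg y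
  refine (isSectionAt_iff (mk_eq_germAt_nsmul he _) _).mpr ?_
  rw [Units.val_pow_eq_pow_val, mul_comm]
  exact coeff_minpoly_mul_pow_mem_range e.ne_zero hint h i

theorem exists_isNonvanishingAt_coeff {D : CartierDivisor Y} {g : X.functionField} {x : X}
    {P : Y.functionField[X]} (hP : P.Monic) (hPg : P.eval₂ (functionFieldMap f) g = 0)
    (hcoeff : ∀ i, IsSectionAt ((P.natDegree - i) • D) (P.coeff i) (f x))
    (hg : IsNonvanishingAt (pullbackCartier f D) g x) :
    ∃ i < P.natDegree, IsNonvanishingAt ((P.natDegree - i) • D) (P.coeff i) (f x) := by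
  obtain ⟨e, he⟩ := QuotientGroup.mk_surjective (germAt D (f x))
  obtain ⟨u, hu, hug⟩ :=
    (isNonvanishingAt_iff _ _ _ _ (mk_map_eq_germAt_pullbackCartier f he)).mp hg
  have hlift : P.scaleRoots (e : Y.functionField) ∈
      lifts (algebraMap (Y.presheaf.stalk (f x)) Y.functionField) := by
    refine (lifts_iff_coeff_lifts _).mpr fun i ↦ ?_
    rw [coeff_scaleRoots, mul_comm, ← Units.val_pow_eq_pow_val]
    exact (isSectionAt_iff (mk_eq_germAt_nsmul he _) _).mp (hcoeff i)
  obtain ⟨p, hpP, hdeg, hp⟩ :=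
    lifts_and_natDegree_eq_and_monic hlift ((monic_scaleRoots_iff _).mpr hP)
  rw [natDegree_scaleRoots] at hdeg
  have hcomp : (algebraMap (X.presheaf.stalk x) X.functionField).comp (f.stalkMap x).hom =
      (functionFieldMap f).comp (algebraMap (Y.presheaf.stalk (f x)) Y.functionField) :=
    RingHom.ext fun a ↦ (functionFieldMap_algebraMap f x a).symm
  have hroot : p.eval₂ (f.stalkMap x).hom u = 0 := by
    apply IsFractionRing.injective (X.presheaf.stalk x) X.functionField
    rw [hom_eval₂, hcomp, ← eval₂_map, hpP, hug, map_zero]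
    exact scaleRoots_eval₂_eq_zero _ hPg
  obtain ⟨i, hi, hunit⟩ := exists_isUnit_coeff_of_isUnit_root (f.stalkMap x).hom hp hu hroot
  refine ⟨i, hdeg ▸ hi, (isNonvanishingAt_iff_isUnit (mk_eq_germAt_nsmul he _) ?_).mpr hunit⟩
  rw [← coeff_map, hpP, coeff_scaleRoots, mul_comm, Units.val_pow_eq_pow_val]

variable [IsIntegralHom f] [IsNormalScheme Y]

theorem notMem_stableBaseSet_of_notMem_baseLocus_pullback {L : CartierDivisor Y} {x : X}
    (hx : x ∉ baseLocus (pullbackCartier f L)) : f x ∉ stableBaseSet L := by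
  obtain ⟨g, hg, hgx⟩ := notMem_baseLocus_iff.mp hx
  obtain ⟨P, hP, hPg, hcoeff⟩ := exists_monic_coeff_mem_globalSections f hg
  obtain ⟨i, hi, hix⟩ := exists_isNonvanishingAt_coeff f hP hPg (fun i ↦ hcoeff i (f x)) hgx
  exact notMem_stableBaseSet_iff.mpr ⟨P.natDegree - i, Nat.sub_pos_of_lt hi,
    notMem_baseLocus_iff.mpr ⟨P.coeff i, hcoeff i, hix⟩⟩

theorem stableBaseSet_pullbackCartier (L : CartierDivisor Y) :
    stableBaseSet (pullbackCartier f L) = (stableBaseSet L).preimage f.continuous := by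
  refine Closeds.ext (Set.ext fun x ↦ not_iff_not.mp ⟨fun h ↦ ?_, fun h ↦ ?_⟩)
  · obtain ⟨m, hm, hmx⟩ := notMem_stableBaseSet_iff.mp h
    rw [← map_nsmul] at hmx
    rw [← stableBaseSet_nsmul L hm]
    exact notMem_stableBaseSet_of_notMem_baseLocus_pullback f hmx
  · obtain ⟨m, hm, hmx⟩ := notMem_stableBaseSet_iff.mp h
    refine notMem_stableBaseSet_iff.mpr ⟨m, hm, ?_⟩
    rw [← map_nsmul]
    exact notMem_baseLocus_pullback f hmx

theorem stableBaseSetQ_pullbackQ (D : QDivisor Y) :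
    stableBaseSetQ (pullbackQ f D) = (stableBaseSetQ D).preimage f.continuous := by
  obtain ⟨b, hb, L, hL⟩ := exists_nsmul_eq_one_tmul D
  have hL' : b • pullbackQ f D = 1 ⊗ₜ[ℤ] pullbackCartier f L := by
    rw [← map_nsmul, hL]
    rfl
  rw [stableBaseSetQ_eq hb hL, stableBaseSetQ_eq hb hL', stableBaseSet_pullbackCartier]

theorem augmentedBaseSet_pullbackCartier {ι : Type*} [Fintype ι] (A : CartierDivisor Y)
    (t : ι → ℝ) (B : ι → CartierDivisor Y) :
    augmentedBaseSet (pullbackCartier f A) t (fun i ↦ pullbackCartier f (B i)) =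
      (augmentedBaseSet A t B).preimage f.continuous := by
  simp only [augmentedBaseSet, ← map_zsmul, ← map_sum, ← map_sub, stableBaseSet_pullbackCartier]
  ext x
  simp only [Closeds.coe_preimage, Closeds.coe_iInf, Set.preimage_iInter]

end Descent

theorem vanishingIdeal_preimage {X Y : Scheme.{u}} (f : X ⟶ Y) (W : Closeds Y) :
    Scheme.IdealSheafData.vanishingIdeal (W.preimage f.continuous) =
      reducedPreimage f (Scheme.IdealSheafData.vanishingIdeal W) := by
  rw [reducedPreimage, ← Scheme.IdealSheafData.vanishingIdeal_support,
    Scheme.IdealSheafData.support_comap]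
  congr 2

theorem stableBaseLocus_pullbackQ {X Y : Scheme.{u}} [IsIntegral X] [IsIntegral Y]
    [IsNormalScheme Y] (f : X ⟶ Y) [IsIntegralHom f] [IsDominant f] (D : QDivisor Y) :
    stableBaseLocus (pullbackQ f D) = reducedPreimage f (stableBaseLocus D) := by
  rw [stableBaseLocus, stableBaseSetQ_pullbackQ, vanishingIdeal_preimage, stableBaseLocus]

section VeryAmple

variable (k : Type u) [Field k]

theorem iSup_stdOpen (n : ℕ) : ⨆ j, stdOpen k n j = ⊤ := by
  refine Proj.iSup_basicOpen_eq_top' _ _ (fun j ↦ ⟨1, MvPolynomial.isHomogeneous_X k j⟩) ?_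
  refine eq_top_iff.mpr fun p _ ↦ ?_
  induction p using MvPolynomial.induction_on with
  | C a => exact Subalgebra.algebraMap_mem _ (algebraMap k (polyGrading k n 0) a)
  | add p q hp hq => exact add_mem (hp trivial) (hq trivial)
  | mul_X p j hp => exact mul_mem (hp trivial) (Algebra.subset_adjoin ⟨j, rfl⟩)

variable {k}

theorem IsVeryAmple.notMem_stableBaseSet {X : Scheme.{u}} [IsIntegral X]
    {s : X ⟶ Spec (CommRingCat.of k)} {A : CartierDivisor X} (hA : IsVeryAmple k s A) (x : X) :
    x ∉ stableBaseSet A := by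
  obtain ⟨n, i, -, -, g, hg, hlocus, -⟩ := hA
  obtain ⟨j, hj⟩ := Opens.mem_iSup.mp ((iSup_stdOpen k n).ge (Set.mem_univ (i x)))
  exact notMem_stableBaseSet_of_notMem_baseLocus
    (notMem_baseLocus_iff.mpr ⟨g j, hg j, (hlocus j).ge hj⟩)

theorem augmentedBaseLocus_pullbackR {X Y : Scheme.{u}} [IsIntegral X] [IsIntegral Y]
    [IsNormalScheme Y] {sX : X ⟶ Spec (CommRingCat.of k)} {sY : Y ⟶ Spec (CommRingCat.of k)}
    (f : X ⟶ Y) [IsIntegralHom f] [IsDominant f] {Δ : RDivisor Y} (c : AugmentedChoice k sY Δ)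
    (c' : AugmentedChoice k sX (pullbackR f Δ)) :
    augmentedBaseLocus c' = reducedPreimage f (augmentedBaseLocus c) := by
  have hB (i x) : x ∉ stableBaseSet (pullbackCartier f (c.B i)) := by
    rw [stableBaseSet_pullbackCartier]
    exact (c.isVeryAmple i).notMem_stableBaseSet (f x)
  have hpull : pullbackR f (∑ i, c.t i ⊗ₜ[ℤ] c.B i) =
      ∑ i, c.t i ⊗ₜ[ℤ] pullbackCartier f (c.B i) := map_sum _ _ _
  have hequiv : RLinearEquiv (∑ i, c'.t i ⊗ₜ[ℤ] c'.B i)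
      (∑ i, c.t i ⊗ₜ[ℤ] pullbackCartier f (c.B i)) :=
    c'.equiv.symm.trans (hpull ▸ c.equiv.pullback f)
  have hset := augmentedBaseSet_eq c'.isAmple (c.isAmple.pullback f)
    (fun i ↦ (c'.isVeryAmple i).notMem_stableBaseSet) hB hequiv
  rw [augmentedBaseSet_pullbackCartier] at hset
  exact (congrArg _ hset).trans (vanishingIdeal_preimage f _)

end VeryAmple

end BaseLoci

end

theorem theorem1p1_general {k : Type u} [Field k] {X Y : Scheme.{u}}
    {sX : X ⟶ Spec (CommRingCat.of k)} {sY : Y ⟶ Spec (CommRingCat.of k)}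
    [IsIntegral X] [IsIntegral Y] [BaseLoci.IsNormalScheme Y]
    (f : X ⟶ Y) [IsIntegralHom f] [IsDominant f] :
    (∀ D : BaseLoci.QDivisor Y,
      BaseLoci.stableBaseLocus (BaseLoci.pullbackQ f D) =
        BaseLoci.reducedPreimage f (BaseLoci.stableBaseLocus D)) ∧
    (∀ (Δ : BaseLoci.RDivisor Y) (c : BaseLoci.AugmentedChoice k sY Δ)
      (c' : BaseLoci.AugmentedChoice k sX (BaseLoci.pullbackR f Δ)),
      BaseLoci.augmentedBaseLocus c' =
        BaseLoci.reducedPreimage f (BaseLoci.augmentedBaseLocus c)) :=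
  ⟨BaseLoci.stableBaseLocus_pullbackQ f, fun _ ↦ BaseLoci.augmentedBaseLocus_pullbackR f⟩

theorem theorem1p1 (k : Type u) [Field k] [PerfectField k] (X Y : Scheme.{u})
    (sX : X ⟶ Spec (CommRingCat.of k)) (sY : Y ⟶ Spec (CommRingCat.of k))
    [IsIntegral X] [IsIntegral Y] [BaseLoci.IsNormalScheme X] [BaseLoci.IsNormalScheme Y]
    (hX : BaseLoci.IsProjectiveOver k X sX) (hY : BaseLoci.IsProjectiveOver k Y sY)
    (f : X ⟶ Y) (hf : f ≫ sY = sX) [IsFinite f] [Surjective f] :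
    (∀ D : BaseLoci.QDivisor Y,
      BaseLoci.stableBaseLocus (BaseLoci.pullbackQ f D) =
        BaseLoci.reducedPreimage f (BaseLoci.stableBaseLocus D)) ∧
    (∀ (Δ : BaseLoci.RDivisor Y) (c : BaseLoci.AugmentedChoice k sY Δ)
      (c' : BaseLoci.AugmentedChoice k sX (BaseLoci.pullbackR f Δ)),
      BaseLoci.augmentedBaseLocus c' =
        BaseLoci.reducedPreimage f (BaseLoci.augmentedBaseLocus c)) :=
  theorem1p1_general f
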